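/- **Setting.** Let $\mathcal G[t]=(\mathcal V,\mathcal E[t])$, $t\in\mathbb Z_{\ge 0}$, be simple digraphs on a finite set $\mathcal V$; $(j,i)\in\mathcal E[t]$ means that $i$ receives information from $j$ at time $t$, and $\mathcal N_i[t]=\{j:(j,i)\in\mathcal E[t]\}$. The vertices are partitioned into leaders $\mathcal L$ and followers $\mathcal F$, $f=|\mathcal F|$, and also into adversaries $\mathcal A$ and normal agents $\mathcal M=\mathcal V\setminus\mathcal A$; put $\mathcal L_{\mathcal M}=\mathcal L\cap\mathcal M\neq\emptyset$ and $\mathcal F_{\mathcal M}=\mathcal F\cap\mathcal M\ne\emptyset$. Let $F\in\mathbb Z_{\geq 0}$ and let $f_r:\mathbb Z_{\ge0}\to\mathbb R$ be the reference signal. The set $\mathcal A$ is *$F$-local*: $|\mathcal N_i[t]\cap\mathcal A|\le F$ for all $i\in\mathcal M$ and all $t$. An adversary $a$ sends to each out-neighbor $u$ an arbitrary real number $x_a^u[t]$ at every time $t$, and activation values $q_a^u[t,k]$, $0\le k\le f$, which are *admissible*: $q_a^u[t,k]\in\{0,1\}$, and if $q_a^u[t,k']=1$ with $k'<f$, then $q_a^u[t,k'']=1$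 for all $k'\le k''\le f$. Normal agents $j$ send their true values: $q_j^i[t,k]=q_j[t,k]$ and $x_j^i[t]=x_j[t]$. **BP-MSR algorithm with parameter $F$.** At time $t$ each normal agent sets $q_i[t,0]=1$ if $i\in\mathcal L$ and $q_i[t,0]=0$ if $i\in\mathcal F$; for $k=1,\dots,f$ it sets $q_i[t,k]=1$ if $q_i[t,k-1]=1$ or $\sum_{j\in\mathcal N_i[t]}q_j^i[t,k-1]\ge 2F+1$, and $q_i[t,k]=0$ otherwise. Put $q_i[t]=q_i[t,f]$. * A normal leader sets $x_i[t+1]=f_r[t]$. * A normal follower with $q_i[t]\neq 1$ sets $x_i[t+1]=x_i[t]$. * A normal follower with $q_i[t]=1$ considers the set $\mathcal I_i[t]$ consisting of $i$ and of all in-neighbors that transmit (leaders and adversaries always transmit, a normal follower $j$ transmits if and only if $q_j[t]=1$). Among the agents $j\in\mathcal I_i[t]$ with $x_j^i[t]>x_i[t]$ it discards $F$ with the largest values (all of them if there are fewer than $F$), and among those with $x_j^i[t]<x_i[t]$ it discards $F$ with the smallest values (all of them if there are fewer than $F$); ties are broken arbitrarily. If $\mathcal R_i[t]$ is the set of discarded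 agents, then $x_i[t+1]=\sum_{j\in\mathcal I_i[t]\setminus\mathcal R_i[t]}w_{ij}[t]\,x_j^i[t]$, where $w_{ij}[t]\ge\alpha$ for $j\in\mathcal I_i[t]\setminus\mathcal R_i[t]$, $w_{ij}[t]=0$ for all other $j$, and $\sum_j w_{ij}[t]=1$. Here $\alpha\in(0,1)$ is a constant independent of $i,j,t$. Let $m[t]=\min_{i\in\mathcal M}x_i[t]$ and $M[t]=\max_{i\in\mathcal M}x_i[t]$. **Theorem.** Suppose that $\mathcal A$ is $F$-local, that the activation values sent by the adversaries are admissible, that $f_r[t]=C_r$ for all $t\ge t_C$, and that every $i\in\mathcal M$ runs the BP-MSR algorithm with parameter $F$ at all times $t\ge t_C$. 1. If $C_r\in[m[t_C],M[t_C]]$ (for instance, if the normal leaders already have state $C_r$ at time $t_C$), then $x_i[t]\in[m[t_C],M[t_C]]$ for all $i\in\mathcal F_{\mathcal M}$ and all $t\ge t_C$. 2. Let $\mathcal F_{\mathcal C}=\{i\in\mathcal F_{\mathcal M}:\limsup_{t\to\infty}q_i[t]=1\}$. If $\mathcal F_{\mathcal C}\neq\emptyset$, then the followers in $\mathcal F_{\mathcal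 C}$ achieve partial resilient leader-follower consensus: for all initial states and all values $x_a^u[t]$ sent by the adversaries, $\lim_{t\to\infty}|x_i[t]-f_r[t]|=0$, that is $x_i[t]\to C_r$, for every $i\in\mathcal F_{\mathcal C}$. -/

import Mathlib

open Filter Topology

/-- A leader-follower network on a finite vertex set `V`: a sequence of simple digraphs on `V`
(`(graph t).Adj j i` means that `i` receives information from `j` at time `t`), the set of leaders
(all other vertices are followers) and the set of adversaries (all other vertices are normal).
There is at least one normal leader and at least one normal follower. -/
structure LFNetwork (V : Type*) [Fintype V] [DecidableEq V] where
  graph : ℕ → Digraph V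
  loopless : ∀ t i, ¬ (graph t).Adj i i
  leaders : Finset V
  adversaries : Finset V
  exists_normal_leader : (leaders \ adversaries).Nonempty
  exists_normal_follower : (leadersᶜ \ adversaries).Nonempty

namespace LFNetwork

variable {V : Type*} [Fintype V] [DecidableEq V] (N : LFNetwork V)

/-- The set of followers. -/
def followers : Finset V := N.leadersᶜ

/-- The set of normal agents. -/
def normal : Finset V := N.adversariesᶜ

/-- The set of normal followers. -/
def normalFollowers : Finset V := N.followers \ N.adversaries

theorem normal_nonempty : N.normal.Nonempty := by
  obtain ⟨i, hi⟩ := N.exists_normal_leader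
  exact ⟨i, by simp only [Finset.mem_sdiff] at hi; simp [normal, hi.2]⟩

open Classical in
/-- The in-neighbors of `i` at time `t`. -/
noncomputable def inNbrs (t : ℕ) (i : V) : Finset V :=
  Finset.univ.filter fun j => (N.graph t).Adj j i

/-- The set `S` is `F`-local: at every time, every vertex outside `S` has at most `F` in-neighbors
in `S`. -/
def IsLocal (F : ℕ) (S : Finset V) : Prop :=
  ∀ t : ℕ, ∀ i ∉ S, (N.inNbrs t i ∩ S).card ≤ F

/-- Constraint on the activation values sent by adversaries; `qmsg t k a u` is the value that the
adversary `a` sends to its out-neighbor `u` at time `t` and iteration `k`. The values are binary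
and are never switched from `1` back to `0` during the iterations of one time step. -/
def AdmissibleActivation (qmsg : ℕ → ℕ → V → V → ℝ) : Prop :=
  ∀ t : ℕ, ∀ a ∈ N.adversaries, ∀ u : V, (N.graph t).Adj a u →
    (∀ k ≤ N.followers.card, qmsg t k a u = 0 ∨ qmsg t k a u = 1) ∧
    (∀ k' < N.followers.card, qmsg t k' a u = 1 →
      ∀ k'', k' ≤ k'' → k'' ≤ N.followers.card → qmsg t k'' a u = 1)

open Classical in
/-- Bootstrap percolation with threshold `r` at time `t`: the activation state of agent `i` after
`k` iterations. A normal agent sends its true activation state, an adversary `a` sends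
`qmsg t k a i` to `i`. (The value computed here for an adversary is not used by anyone.) -/
noncomputable def activationAt (r : ℕ) (qmsg : ℕ → ℕ → V → V → ℝ) (t : ℕ) : ℕ → V → ℝ
  | 0, i => if i ∈ N.leaders then 1 else 0
  | k + 1, i =>
      if activationAt r qmsg t k i = 1 then 1
      else if (r : ℝ) ≤ ∑ j ∈ N.inNbrs t i,
          (if j ∈ N.adversaries then qmsg t k j i else activationAt r qmsg t k j) then 1
      else 0

/-- The final activation state of agent `i` at time `t`: as many iterations of bootstrap percolation
with threshold `2 F + 1` as there are followers. -/
noncomputable def activation (F : ℕ) (qmsg : ℕ → ℕ → V → V → ℝ) (t : ℕ) (i : V) : ℝ :=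
  N.activationAt (2 * F + 1) qmsg t N.followers.card i

/-- The consensus value of agent `j` received by agent `i`, where `x` are the true states at the
current time and `xmsg a u` is the value that the adversary `a` sends to `u`. -/
def received (x : V → ℝ) (xmsg : V → V → ℝ) (i j : V) : ℝ :=
  if j ∈ N.adversaries then xmsg j i else x j

open Classical in
/-- The agents whose consensus values are available to `i` at time `t`: agent `i` itself and the
in-neighbors of `i` that transmit. Leaders and adversaries always transmit, a normal follower
transmits exactly when it is active. -/
noncomputable def inbox (F : ℕ) (qmsg : ℕ → ℕ → V → V → ℝ) (t : ℕ) (i : V) : Finset V :=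
  insert i ((N.inNbrs t i).filter fun j =>
    j ∈ N.leaders ∨ j ∈ N.adversaries ∨ N.activation F qmsg t j = 1)

end LFNetwork

open Classical in
/-- `R` is a possible set of agents discarded by an agent with own value `own` which has the values
`v j`, `j ∈ I`: among the agents with a value larger than `own`, `F` with the largest values (all,
if there are fewer than `F`), and among the agents with a value smaller than `own`, `F` with the
smallest values (all, if there are fewer than `F`). Ties may be broken in any way. -/
def IsDiscarded {V : Type*} (F : ℕ) (I : Finset V) (v : V → ℝ) (own : ℝ) (R : Finset V) : Prop :=
  ∃ RH RO : Finset V,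
    (RH ⊆ I.filter (fun j => own < v j) ∧
      RH.card = min F (I.filter (fun j => own < v j)).card ∧
      ∀ j ∈ RH, ∀ k ∈ I.filter (fun j => own < v j), k ∉ RH → v k ≤ v j) ∧
    (RO ⊆ I.filter (fun j => v j < own) ∧
      RO.card = min F (I.filter (fun j => v j < own)).card ∧
      ∀ j ∈ RO, ∀ k ∈ I.filter (fun j => v j < own), k ∉ RO → v j ≤ v k) ∧
    R = RH ∪ RO

namespace LFNetwork

variable {V : Type*} [Fintype V] [DecidableEq V] (N : LFNetwork V)

/-- The update of an active follower `i` at time `t` from the states `x` to its new state `y`: a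
weighted average of the available values that are not discarded, with all weights at least `α`. -/
def MSRUpdate (F : ℕ) (qmsg : ℕ → ℕ → V → V → ℝ) (α : ℝ) (t : ℕ) (x : V → ℝ) (xmsg : V → V → ℝ)
    (i : V) (y : ℝ) : Prop :=
  ∃ (R : Finset V) (w : V → ℝ),
    IsDiscarded F (N.inbox F qmsg t i) (N.received x xmsg i) (x i) R ∧
    (∀ j ∈ N.inbox F qmsg t i \ R, α ≤ w j) ∧
    (∀ j ∉ N.inbox F qmsg t i \ R, w j = 0) ∧
    ∑ j, w j = 1 ∧
    y = ∑ j ∈ N.inbox F qmsg t i \ R, w j * N.received x xmsg i j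

/-- The states `x t i` form an execution in which all normal agents run the BP-MSR algorithm with
parameter `F` at all times `t ≥ t₀`, with reference signal `fr`, when the adversaries send the
activation values `qmsg` and the consensus values `xmsg t a u`. The states at time `t₀` and the
values `xmsg` are arbitrary, and a single `α ∈ (0, 1)` bounds all weights from below. -/
def IsExecution (F : ℕ) (qmsg : ℕ → ℕ → V → V → ℝ) (fr : ℕ → ℝ) (t₀ : ℕ)
    (x : ℕ → V → ℝ) (xmsg : ℕ → V → V → ℝ) : Prop :=
  ∃ α : ℝ, 0 < α ∧ α < 1 ∧ ∀ t ≥ t₀, ∀ i ∈ N.normal,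
    (i ∈ N.leaders → x (t + 1) i = fr t) ∧
    (i ∈ N.followers → N.activation F qmsg t i = 1 →
      N.MSRUpdate F qmsg α t (x t) (xmsg t) i (x (t + 1) i)) ∧
    (i ∈ N.followers → N.activation F qmsg t i ≠ 1 → x (t + 1) i = x t i)

/-- The smallest state of a normal agent. -/
noncomputable def minState (x : V → ℝ) : ℝ := N.normal.inf' N.normal_nonempty x

/-- The largest state of a normal agent. -/
noncomputable def maxState (x : V → ℝ) : ℝ := N.normal.sup' N.normal_nonempty x

/-- The normal followers `i` with `limsup_t q_i[t] = 1`. -/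
def convergentSet (F : ℕ) (qmsg : ℕ → ℕ → V → V → ℝ) : Set V :=
  {i | i ∈ N.normalFollowers ∧ limsup (fun t => N.activation F qmsg t i) atTop = 1}

/-- The nonempty set `S` of normal followers achieves partial resilient leader-follower consensus
under the BP-MSR algorithm: for all initial states and all consensus values sent by the adversaries,
the states of the agents in `S` converge to the reference. -/
def PartialConsensus (F : ℕ) (qmsg : ℕ → ℕ → V → V → ℝ) (fr : ℕ → ℝ) (t₀ : ℕ) (S : Set V) : Prop :=
  S.Nonempty ∧ S ⊆ (N.normalFollowers : Set V) ∧
    ∀ (x : ℕ → V → ℝ) (xmsg : ℕ → V → V → ℝ), N.IsExecution F qmsg fr t₀ x xmsg →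
      ∀ i ∈ S, Tendsto (fun t => ‖x t i - fr t‖) atTop (𝓝 0)

end LFNetwork

/-! The dynamics commute with negation, so only upper bounds need proof. By `F`-locality, a retained
adversarial value is dominated by the agent's own value or by some normal value it receives. Hence
any bound on the transmitting normal agents that also bounds the reference persists; this gives part
1.

For part 2, call a normal agent recurrent if it is active infinitely often. From some time on only
recurrent agents are active, and normal leaders sit at `C`. Let `c` bound the recurrent values and
let `C ≤ s ≤ c`. If an active normal agent lies above `s`, take one activated in the earliest
iteration: it has at least `F + 1` normal in-neighbors activated before it, all with values at most
`s`. It retains one of them and drops to at most `α s + (1 - α) c`, while agents at or below `s`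
stay below that level thanks to their own weight (`exists_active_retains_le`,
`IsTail.above_succ_ssubset`). If nobody above `s` is active, the set above `s` does not grow.
Recurrence forces a drop eventually, so raising the level `|V|` times empties the set and contracts
`c - C` by the factor `1 - α ^ |V|`. -/

/-! ### The discarding rule and weighted averages. -/

theorem IsDiscarded.neg {V : Type*} {F : ℕ} {I : Finset V} {v : V → ℝ} {own : ℝ} {R : Finset V}
    (h : IsDiscarded F I v own R) : IsDiscarded F I (fun j => -v j) (-own) R := by
  obtain ⟨RH, RO, ⟨h1, h2, h3⟩, ⟨h4, h5, h6⟩, rfl⟩ := h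
  classical
  refine ⟨RO, RH, ?_, ?_, Finset.union_comm _ _⟩
  · simp only [neg_lt_neg_iff, neg_le_neg_iff]
    exact ⟨h4, h5, h6⟩
  · simp only [neg_lt_neg_iff, neg_le_neg_iff]
    exact ⟨h1, h2, h3⟩

/-- A retained value which exceeds the own value is dominated by every large set of competitors. -/
theorem IsDiscarded.exists_ge {V : Type*} [DecidableEq V] {F : ℕ} {I : Finset V} {v : V → ℝ}
    {own : ℝ} {R A : Finset V} (h : IsDiscarded F I v own R) (hA : (I ∩ A).card ≤ F)
    {j : V} (hj : j ∈ I \ R) (hjA : j ∈ A) (hlt : own < v j) :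
    ∃ p ∈ I, p ∉ A ∧ v j ≤ v p := by
  classical
  obtain ⟨RH, RO, ⟨h1, h2, h3⟩, -, hR⟩ := h
  have hjI : j ∈ I := (Finset.mem_sdiff.1 hj).1
  have hjRH : j ∉ RH := fun hh => (Finset.mem_sdiff.1 hj).2 (by
    rw [hR]; simp [hh])
  have hjf : j ∈ I.filter (fun j => own < v j) := Finset.mem_filter.2 ⟨hjI, hlt⟩
  -- A larger value survives, so the discarded set is not everything above `own` and has full size
  -- `F`.
  have hcard : RH.card = F := by
    rw [h2, min_eq_left]
    by_contra hc
    have : RH = I.filter (fun j => own < v j) :=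
      Finset.eq_of_subset_of_card_le (by simpa using h1) (by simp only [h2]; omega)
    exact hjRH (this ▸ hjf)
  by_contra hno
  push Not at hno
  -- Otherwise `j` and the `F` discarded values above it would be `F + 1` elements of `I ∩ A`.
  have hsub : insert j RH ⊆ I ∩ A := by
    intro p hp
    rcases Finset.mem_insert.1 hp with rfl | hp
    · exact Finset.mem_inter.2 ⟨hjI, hjA⟩
    · have hpI := (Finset.mem_filter.1 (h1 hp)).1
      refine Finset.mem_inter.2 ⟨hpI, ?_⟩
      by_contra hpA
      exact absurd (h3 p hp j (by simpa using hjf) hjRH) (not_le.2 (hno p hpI hpA))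
  have := Finset.card_le_card hsub
  rw [Finset.card_insert_of_notMem hjRH] at this
  omega

/-- Among more than `F` values smaller than the own value, at least one is retained. -/
theorem IsDiscarded.exists_retained {V : Type*} [DecidableEq V] {F : ℕ} {I : Finset V} {v : V → ℝ}
    {own : ℝ} {R G : Finset V} (h : IsDiscarded F I v own R) (hG : G ⊆ I) (hF : F < G.card)
    (hlt : ∀ j ∈ G, v j < own) : ∃ j ∈ G, j ∈ I \ R := by
  classical
  obtain ⟨RH, RO, ⟨h1, -, -⟩, ⟨-, h5, -⟩, hR⟩ := h
  have : RO.card < G.card := by rw [h5]; exact (min_le_left _ _).trans_lt hF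
  obtain ⟨j, hj, hjn⟩ := Finset.exists_mem_notMem_of_card_lt_card this
  refine ⟨j, hj, Finset.mem_sdiff.2 ⟨hG hj, fun hjR => ?_⟩⟩
  simp only [hR, Finset.mem_union] at hjR
  rcases hjR with hh | hh
  · exact lt_asymm (Finset.mem_filter.1 (h1 hh)).2 (hlt j hj)
  · exact hjn hh

theorem IsDiscarded.own_notMem {V : Type*} {F : ℕ} {I : Finset V} {v : V → ℝ}
    {own : ℝ} {R : Finset V} (h : IsDiscarded F I v own R) {i : V} (hi : v i = own) : i ∉ R := by
  classical
  obtain ⟨RH, RO, ⟨h1, -, -⟩, ⟨h4, -, -⟩, hR⟩ := h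
  intro hiR
  rw [hR] at hiR
  rcases Finset.mem_union.1 hiR with hh | hh
  · exact absurd (Finset.mem_filter.1 (h1 hh)).2 (by simp [hi])
  · exact absurd (Finset.mem_filter.1 (h4 hh)).2 (by simp [hi])

/-- A weighted average is bounded by giving weight `α` to one value and the rest to an upper
bound. -/
theorem weighted_sum_le {V : Type*} [Fintype V] [DecidableEq V] {K : Finset V} {w v : V → ℝ}
    {α c s : ℝ} (hα : 0 < α) (hw : ∀ j ∈ K, α ≤ w j) (hw0 : ∀ j ∉ K, w j = 0)
    (hw1 : ∑ j, w j = 1) (hv : ∀ j ∈ K, v j ≤ c) {k : V} (hk : k ∈ K) (hks : v k ≤ s)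
    (hsc : s ≤ c) : ∑ j ∈ K, w j * v j ≤ α * s + (1 - α) * c := by
  have hsum : ∑ j ∈ K, w j = 1 := by
    rw [← hw1]
    exact Finset.sum_subset (Finset.subset_univ K) fun j _ hj => hw0 j hj
  have h1 : ∑ j ∈ K, w j * (c - v j) ≥ w k * (c - v k) :=
    Finset.single_le_sum (f := fun j => w j * (c - v j))
      (fun j hj => mul_nonneg (hα.le.trans (hw j hj)) (sub_nonneg.2 (hv j hj))) hk
  have h2 : ∑ j ∈ K, w j * (c - v j) = c - ∑ j ∈ K, w j * v j := by
    simp only [mul_sub, Finset.sum_sub_distrib, ← Finset.sum_mul, hsum, one_mul]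
  have h3 : α * (c - s) ≤ w k * (c - v k) :=
    mul_le_mul (hw k hk) (by linarith) (by linarith) (hα.le.trans (hw k hk))
  linarith

/-! ### Activation, negation symmetry and one-step bounds. -/

namespace LFNetwork

variable {V : Type*} [Fintype V] [DecidableEq V] {N : LFNetwork V} {F : ℕ}
  {qmsg : ℕ → ℕ → V → V → ℝ}

theorem mem_normal {i : V} : i ∈ N.normal ↔ i ∉ N.adversaries := by
  simp [normal]

theorem mem_followers {i : V} : i ∈ N.followers ↔ i ∉ N.leaders := by
  simp [followers]

theorem activationAt_eq_zero_or_one (r : ℕ) (t k : ℕ) (i : V) :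
    N.activationAt r qmsg t k i = 0 ∨ N.activationAt r qmsg t k i = 1 := by
  cases k with
  | zero => rw [activationAt]; split_ifs <;> simp
  | succ k => rw [activationAt]; split_ifs <;> simp

theorem activationAt_mono {r t k l : ℕ} (hkl : k ≤ l) {i : V}
    (h : N.activationAt r qmsg t k i = 1) : N.activationAt r qmsg t l i = 1 := by
  induction l, hkl using Nat.le_induction with
  | base => exact h
  | succ l _ ih => rw [activationAt, if_pos ih]

theorem activation_eq_one_of_mem_leaders {t : ℕ} {i : V} (hi : i ∈ N.leaders) :
    N.activation F qmsg t i = 1 :=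
  activationAt_mono (Nat.zero_le _) (by rw [activationAt, if_pos hi])

/-- The activation takes only the values 0 and 1, so its limsup is 1 exactly when 1 recurs. -/
theorem limsup_activation_eq_one_iff {i : V} :
    limsup (fun t => N.activation F qmsg t i) atTop = 1 ↔
      ∃ᶠ t in atTop, N.activation F qmsg t i = 1 := by
  have h01 : ∀ t, N.activation F qmsg t i = 0 ∨ N.activation F qmsg t i = 1 :=
    fun t => activationAt_eq_zero_or_one _ _ _ _
  have hle : ∀ t, N.activation F qmsg t i ≤ 1 := fun t => by
    rcases h01 t with h | h <;> rw [h]; exact zero_le_one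
  have hge : ∀ t, 0 ≤ N.activation F qmsg t i := fun t => by
    rcases h01 t with h | h <;> rw [h]; exact zero_le_one
  constructor
  · intro h
    by_contra hf
    rw [not_frequently] at hf
    have : limsup (fun t => N.activation F qmsg t i) atTop = limsup (fun _ : ℕ => (0 : ℝ)) atTop :=
      limsup_congr (hf.mono fun t ht => (h01 t).resolve_right ht)
    rw [this, limsup_const] at h
    exact zero_ne_one h
  · intro h
    apply le_antisymm
    · exact limsup_le_of_le
        (IsCoboundedUnder.of_frequently_ge (a := 0) (Frequently.of_forall hge))
        (Eventually.of_forall hle)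
    · exact le_limsup_of_frequently_le (h.mono fun t ht => ht.ge)
        ⟨1, eventually_map.2 (Eventually.of_forall hle)⟩

theorem received_of_mem_normal {x : V → ℝ} {xmsg : V → V → ℝ} {i j : V} (hj : j ∈ N.normal) :
    N.received x xmsg i j = x j := by
  rw [received, if_neg (mem_normal.1 hj)]

theorem received_neg (x : V → ℝ) (xmsg : V → V → ℝ) (i : V) :
    N.received (fun j => -x j) (fun a u => -xmsg a u) i = fun j => -N.received x xmsg i j := by
  funext j
  simp only [received]
  split_ifs <;> rfl

theorem MSRUpdate.neg {α : ℝ} {t : ℕ} {x : V → ℝ} {xmsg : V → V → ℝ} {i : V} {y : ℝ}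
    (h : N.MSRUpdate F qmsg α t x xmsg i y) :
    N.MSRUpdate F qmsg α t (fun j => -x j) (fun a u => -xmsg a u) i (-y) := by
  obtain ⟨R, w, h1, h2, h3, h4, h5⟩ := h
  refine ⟨R, w, ?_, h2, h3, h4, ?_⟩
  · rw [received_neg]; exact h1.neg
  · rw [received_neg, h5]; simp

theorem IsExecution.neg {fr : ℕ → ℝ} {t₀ : ℕ} {x : ℕ → V → ℝ} {xmsg : ℕ → V → V → ℝ}
    (h : N.IsExecution F qmsg fr t₀ x xmsg) :
    N.IsExecution F qmsg (fun t => -fr t) t₀ (fun t j => -x t j) (fun t a u => -xmsg t a u) := by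
  obtain ⟨α, h0, h1, h⟩ := h
  refine ⟨α, h0, h1, fun t ht i hi => ⟨fun hl => ?_, fun hf ha => ?_, fun hf ha => ?_⟩⟩
  · exact congrArg Neg.neg ((h t ht i hi).1 hl)
  · exact ((h t ht i hi).2.1 hf ha).neg
  · exact congrArg Neg.neg ((h t ht i hi).2.2 hf ha)

theorem mem_inbox_self (t : ℕ) (i : V) : i ∈ N.inbox F qmsg t i := by
  simp [inbox]

theorem card_inbox_inter_adversaries_le (hF : N.IsLocal F N.adversaries) (t : ℕ) {i : V}
    (hi : i ∈ N.normal) : (N.inbox F qmsg t i ∩ N.adversaries).card ≤ F := by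
  refine (Finset.card_le_card ?_).trans (hF t i (mem_normal.1 hi))
  intro j hj
  obtain ⟨hj1, hj2⟩ := Finset.mem_inter.1 hj
  refine Finset.mem_inter.2 ⟨?_, hj2⟩
  rcases Finset.mem_insert.1 hj1 with rfl | hj1
  · exact absurd hj2 (mem_normal.1 hi)
  · exact (Finset.mem_filter.1 hj1).1

/-- If all normal agents that transmit to an active follower have values at most `c`, then so have
all agents that it retains. -/
theorem received_le_of_retained (hF : N.IsLocal F N.adversaries) {t : ℕ} {x : V → ℝ}
    {xmsg : V → V → ℝ} {i : V} (hi : i ∈ N.normal) (hact : N.activation F qmsg t i = 1)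
    {R : Finset V} (hR : IsDiscarded F (N.inbox F qmsg t i) (N.received x xmsg i) (x i) R) {c : ℝ}
    (hc : ∀ p ∈ N.normal, N.activation F qmsg t p = 1 → x p ≤ c) :
    ∀ j ∈ N.inbox F qmsg t i \ R, N.received x xmsg i j ≤ c := by
  have key : ∀ p ∈ N.inbox F qmsg t i, p ∉ N.adversaries → N.received x xmsg i p ≤ c := by
    intro p hp hpA
    rw [received_of_mem_normal (mem_normal.2 hpA)]
    refine hc p (mem_normal.2 hpA) ?_
    rcases Finset.mem_insert.1 hp with rfl | hp
    · exact hact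
    · rcases (Finset.mem_filter.1 hp).2 with h | h | h
      · exact activation_eq_one_of_mem_leaders h
      · exact absurd h hpA
      · exact h
  intro j hj
  by_cases hjA : j ∈ N.adversaries
  · rcases le_or_gt (N.received x xmsg i j) (x i) with hle | hlt
    · exact hle.trans (hc i hi hact)
    · obtain ⟨p, hp, hpA, hjp⟩ :=
        hR.exists_ge (card_inbox_inter_adversaries_le hF t hi) hj hjA hlt
      exact hjp.trans (key p hp hpA)
  · exact key j (Finset.mem_sdiff.1 hj).1 hjA

/-- The new state of an active follower, if its old state is at most `s` and all transmitting normal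
agents have values at most `c`. -/
theorem MSRUpdate.le {α : ℝ} (hα : 0 < α) (hF : N.IsLocal F N.adversaries) {t : ℕ} {x : V → ℝ}
    {xmsg : V → V → ℝ} {i : V} {y : ℝ} (h : N.MSRUpdate F qmsg α t x xmsg i y)
    (hi : i ∈ N.normal) (hact : N.activation F qmsg t i = 1) {s c : ℝ}
    (hc : ∀ p ∈ N.normal, N.activation F qmsg t p = 1 → x p ≤ c) (his : x i ≤ s) (hsc : s ≤ c) :
    y ≤ α * s + (1 - α) * c := by
  obtain ⟨R, w, h1, h2, h3, h4, rfl⟩ := h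
  have hrec : N.received x xmsg i i = x i := received_of_mem_normal hi
  exact weighted_sum_le hα h2 h3 h4 (received_le_of_retained hF hi hact h1 hc)
    (Finset.mem_sdiff.2 ⟨mem_inbox_self t i, h1.own_notMem hrec⟩) (hrec.trans_le his) hsc

/-! ### Consequences of bootstrap percolation. -/

open Classical in
/-- A normal agent that becomes active in some iteration has more than `F` normal in-neighbors that
are already active. -/
theorem lt_card_active_inNbrs (hF : N.IsLocal F N.adversaries)
    (hq : N.AdmissibleActivation qmsg) {t k : ℕ} (hk : k < N.followers.card) {i : V}
    (hi : i ∈ N.normal) (h0 : N.activationAt (2 * F + 1) qmsg t k i ≠ 1)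
    (h1 : N.activationAt (2 * F + 1) qmsg t (k + 1) i = 1) :
    F < ((N.inNbrs t i).filter fun j =>
      j ∉ N.adversaries ∧ N.activationAt (2 * F + 1) qmsg t k j = 1).card := by
  rw [activationAt, if_neg h0] at h1
  have hsum : ((2 * F + 1 : ℕ) : ℝ) ≤ ∑ j ∈ N.inNbrs t i,
      (if j ∈ N.adversaries then qmsg t k j i
        else N.activationAt (2 * F + 1) qmsg t k j) := by
    by_contra hno
    rw [if_neg hno] at h1
    exact zero_ne_one h1
  -- Adversaries contribute at most `F` to a sum of at least `2F + 1`, which leaves `F + 1` active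
  -- normal in-neighbors.
  have hb : ∑ j ∈ N.inNbrs t i, (if j ∈ N.adversaries then qmsg t k j i
        else N.activationAt (2 * F + 1) qmsg t k j) ≤
      ∑ j ∈ N.inNbrs t i, ((if j ∈ N.adversaries then (1 : ℝ) else 0) +
        if j ∉ N.adversaries ∧ N.activationAt (2 * F + 1) qmsg t k j = 1 then (1 : ℝ) else 0) := by
    refine Finset.sum_le_sum fun j hj => ?_
    by_cases hjA : j ∈ N.adversaries
    · have hadj : (N.graph t).Adj j i := (Finset.mem_filter.1 hj).2
      rcases (hq t j hjA i hadj).1 k hk.le with h | h <;> simp [hjA, h]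
    · rcases activationAt_eq_zero_or_one (N := N) (qmsg := qmsg) (2 * F + 1) t k j with h | h <;>
        simp [hjA, h]
  rw [Finset.sum_add_distrib, Finset.sum_boole, Finset.sum_boole, Finset.filter_mem_eq_inter]
    at hb
  have hlocal := hF t i (mem_normal.1 hi)
  have := hsum.trans hb
  norm_cast at this
  omega

/-- If all normal leaders have values at most `s` but some active normal follower has a larger
value, then some active normal follower with a value larger than `s` retains a value at most `s`. -/
theorem exists_active_retains_le (hF : N.IsLocal F N.adversaries)
    (hq : N.AdmissibleActivation qmsg) {t : ℕ} {x : V → ℝ} {s : ℝ}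
    (hlead : ∀ p ∈ N.normal, p ∈ N.leaders → x p ≤ s)
    (hex : ∃ i ∈ N.normal, N.activation F qmsg t i = 1 ∧ s < x i) :
    ∃ i ∈ N.normal, i ∈ N.followers ∧ N.activation F qmsg t i = 1 ∧ s < x i ∧
      ∀ (xmsg : V → V → ℝ) (R : Finset V),
        IsDiscarded F (N.inbox F qmsg t i) (N.received x xmsg i) (x i) R →
        ∃ j ∈ N.inbox F qmsg t i \ R, N.received x xmsg i j ≤ s := by
  classical
  -- The least `k` with `P k` is the first iteration in which a normal agent above `s` is active.
  let P : ℕ → Prop := fun k => ∃ i ∈ N.normal,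
    N.activationAt (2 * F + 1) qmsg t k i = 1 ∧ s < x i
  have hP : ∃ k, P k := ⟨_, hex⟩
  have hle : Nat.find hP ≤ N.followers.card := Nat.find_min' hP hex
  obtain ⟨i, hi, hai, hsi⟩ := Nat.find_spec hP
  have hmin : ∀ k < Nat.find hP, ¬ P k := fun k => Nat.find_min hP
  generalize Nat.find hP = k at hle hai hmin
  have hil : i ∉ N.leaders := fun h => absurd (hlead i hi h) (not_le.2 hsi)
  cases k with
  | zero => rw [activationAt, if_neg hil] at hai; exact absurd hai zero_ne_one
  | succ k =>
    have hk : ¬ P k := hmin k k.lt_succ_self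
    have hact : N.activation F qmsg t i = 1 := activationAt_mono hle hai
    have hcard := lt_card_active_inNbrs hF hq (Nat.lt_of_succ_le hle) hi
      (fun h => hk ⟨i, hi, h, hsi⟩) hai
    refine ⟨i, hi, mem_followers.2 hil, hact, hsi, fun xmsg R hR => ?_⟩
    have hG : ∀ j ∈ (N.inNbrs t i).filter (fun j =>
        j ∉ N.adversaries ∧ N.activationAt (2 * F + 1) qmsg t k j = 1),
        N.received x xmsg i j ≤ s := by
      intro j hj
      obtain ⟨-, hjA, hj1⟩ := Finset.mem_filter.1 hj
      rw [received_of_mem_normal (mem_normal.2 hjA)]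
      by_contra hlt
      exact hk ⟨j, mem_normal.2 hjA, hj1, not_le.1 hlt⟩
    -- Agents active at iteration `k` are active at the end, hence transmit.
    obtain ⟨j, hjG, hj⟩ := hR.exists_retained (fun j hj => by
      obtain ⟨hjn, -, hj1⟩ := Finset.mem_filter.1 hj
      exact Finset.mem_insert_of_mem (Finset.mem_filter.2 ⟨hjn, Or.inr (Or.inr
        (activationAt_mono (Nat.le_of_succ_le hle) hj1))⟩)) hcard
      (fun j hj => (hG j hj).trans_lt hsi)
    exact ⟨j, hj, hG j hjG⟩

/-- The normal agents stay below any bound that holds initially and for the reference. -/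
theorem IsExecution.le_of_le (hF : N.IsLocal F N.adversaries) {fr : ℕ → ℝ} {t₀ : ℕ}
    {x : ℕ → V → ℝ} {xmsg : ℕ → V → V → ℝ} (hx : N.IsExecution F qmsg fr t₀ x xmsg) {c : ℝ}
    (hfr : ∀ t ≥ t₀, fr t ≤ c) (h0 : ∀ i ∈ N.normal, x t₀ i ≤ c) :
    ∀ t ≥ t₀, ∀ i ∈ N.normal, x t i ≤ c := by
  obtain ⟨α, hα, -, hx⟩ := hx
  intro t ht
  induction t, ht using Nat.le_induction with
  | base => exact h0
  | succ t ht ih =>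
    intro i hi
    obtain ⟨hl, ha, hn⟩ := hx t ht i hi
    by_cases hil : i ∈ N.leaders
    · rw [hl hil]; exact hfr t ht
    by_cases hact : N.activation F qmsg t i = 1
    · have := (ha (mem_followers.2 hil) hact).le hα hF hi hact (fun p hp _ => ih p hp)
        (ih i hi) le_rfl
      linarith
    · rw [hn (mem_followers.2 hil) hact]; exact ih i hi

/-! ### Recurrent agents and tails of executions. -/

open Classical in
/-- The normal agents that are active infinitely often. -/
noncomputable def recurrent (N : LFNetwork V) (F : ℕ) (qmsg : ℕ → ℕ → V → V → ℝ) : Finset V :=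
  N.normal.filter fun i => ∃ᶠ t in atTop, N.activation F qmsg t i = 1

theorem mem_recurrent {i : V} : i ∈ N.recurrent F qmsg ↔
    i ∈ N.normal ∧ ∃ᶠ t in atTop, N.activation F qmsg t i = 1 := by
  simp [recurrent]

/-- Each non-recurrent normal agent has a last active time, and there are finitely many agents. -/
theorem eventually_active_subset_recurrent : ∀ᶠ t in atTop, ∀ i ∈ N.normal,
    N.activation F qmsg t i = 1 → i ∈ N.recurrent F qmsg := by
  rw [Filter.eventually_all]
  intro i
  by_cases h : ∃ᶠ t in atTop, N.activation F qmsg t i = 1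
  · exact Eventually.of_forall fun t hi _ => mem_recurrent.2 ⟨hi, h⟩
  · rw [not_frequently] at h
    exact h.mono fun t ht _ hh => absurd hh ht

/-- The recurrent agents with values larger than `s`. -/
noncomputable def above (N : LFNetwork V) (F : ℕ) (qmsg : ℕ → ℕ → V → V → ℝ) (x : V → ℝ) (s : ℝ) :
    Finset V :=
  (N.recurrent F qmsg).filter fun i => s < x i

theorem mem_above {x : V → ℝ} {s : ℝ} {i : V} :
    i ∈ N.above F qmsg x s ↔ i ∈ N.recurrent F qmsg ∧ s < x i :=
  Finset.mem_filter

theorem above_eq_empty_iff {x : V → ℝ} {s : ℝ} :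
    N.above F qmsg x s = ∅ ↔ ∀ i ∈ N.recurrent F qmsg, x i ≤ s := by
  simp [above, Finset.filter_eq_empty_iff]

theorem above_anti {x : V → ℝ} {s s' : ℝ} (h : s ≤ s') :
    N.above F qmsg x s' ⊆ N.above F qmsg x s := fun _ hi =>
  mem_above.2 ⟨(mem_above.1 hi).1, h.trans_lt (mem_above.1 hi).2⟩

/-- A tail of an execution with weights at least `α` in which the normal leaders have the value
`C` and only recurrent agents are active. -/
structure IsTail (N : LFNetwork V) (F : ℕ) (qmsg : ℕ → ℕ → V → V → ℝ) (α C : ℝ) (T : ℕ)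
    (x : ℕ → V → ℝ) (xmsg : ℕ → V → V → ℝ) : Prop where
  pos : 0 < α
  lt_one : α < 1
  leader : ∀ t ≥ T, ∀ i ∈ N.normal, i ∈ N.leaders → x t i = C
  update : ∀ t ≥ T, ∀ i ∈ N.normal, i ∈ N.followers → N.activation F qmsg t i = 1 →
    N.MSRUpdate F qmsg α t (x t) (xmsg t) i (x (t + 1) i)
  keep : ∀ t ≥ T, ∀ i ∈ N.normal, i ∈ N.followers → N.activation F qmsg t i ≠ 1 →
    x (t + 1) i = x t i
  active : ∀ t ≥ T, ∀ i ∈ N.normal, N.activation F qmsg t i = 1 → i ∈ N.recurrent F qmsg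

theorem IsExecution.exists_isTail {fr : ℕ → ℝ} {t₀ : ℕ} {C : ℝ} (hfr : ∀ t ≥ t₀, fr t = C)
    {x : ℕ → V → ℝ} {xmsg : ℕ → V → V → ℝ} (hx : N.IsExecution F qmsg fr t₀ x xmsg) :
    ∃ α T, N.IsTail F qmsg α C T x xmsg := by
  obtain ⟨α, hα, hα1, hx⟩ := hx
  obtain ⟨T, hT⟩ := eventually_atTop.1 (eventually_active_subset_recurrent (N := N) (F := F)
    (qmsg := qmsg))
  have hle : ∀ t ≥ max T (t₀ + 1), T ≤ t ∧ t₀ + 1 ≤ t := fun t ht => max_le_iff.1 ht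
  -- Leaders take the reference value only after their first update, hence `t₀ + 1`.
  refine ⟨α, max T (t₀ + 1), hα, hα1, fun t ht i hi hl => ?_,
    fun t ht i hi => (hx t (by have := hle t ht; omega) i hi).2.1,
    fun t ht i hi => (hx t (by have := hle t ht; omega) i hi).2.2,
    fun t ht => hT t (hle t ht).1⟩
  obtain ⟨t, rfl⟩ : ∃ u, t = u + 1 := ⟨t - 1, by have := hle t ht; omega⟩
  have ht0 : t ≥ t₀ := by have := hle _ ht; omega
  rw [(hx t ht0 i hi).1 hl, hfr t ht0]

variable {α C : ℝ} {T : ℕ} {x : ℕ → V → ℝ} {xmsg : ℕ → V → V → ℝ}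

/-! ### Evolution of the set above a level. -/

/-- If no recurrent agent with a value larger than `s` is active, no new one appears. -/
theorem IsTail.above_succ_subset (h : N.IsTail F qmsg α C T x xmsg)
    (hF : N.IsLocal F N.adversaries) {t : ℕ} (ht : T ≤ t) {s : ℝ} (hCs : C ≤ s)
    (hno : ∀ i ∈ N.normal, N.activation F qmsg t i = 1 → x t i ≤ s) :
    N.above F qmsg (x (t + 1)) s ⊆ N.above F qmsg (x t) s := by
  intro i hi
  obtain ⟨hiS, hsi⟩ := mem_above.1 hi
  have hin := (mem_recurrent.1 hiS).1
  by_cases hil : i ∈ N.leaders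
  · rw [h.leader (t + 1) (by omega) i hin hil] at hsi
    exact absurd hCs (not_le.2 hsi)
  by_cases hact : N.activation F qmsg t i = 1
  · have := (h.update t ht i hin (mem_followers.2 hil) hact).le h.pos hF hin hact hno
      (hno i hin hact) le_rfl
    linarith
  · rw [h.keep t ht i hin (mem_followers.2 hil) hact] at hsi
    exact mem_above.2 ⟨hiS, hsi⟩

/-- If some recurrent agent with a value larger than `s` is active, then one of them drops. -/
theorem IsTail.above_succ_ssubset (h : N.IsTail F qmsg α C T x xmsg)
    (hF : N.IsLocal F N.adversaries) (hq : N.AdmissibleActivation qmsg) {t : ℕ} (ht : T ≤ t)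
    {s c : ℝ} (hCs : C ≤ s) (hsc : s ≤ c) (hc : ∀ i ∈ N.recurrent F qmsg, x t i ≤ c)
    (hex : ∃ i ∈ N.normal, N.activation F qmsg t i = 1 ∧ s < x t i) :
    N.above F qmsg (x (t + 1)) (α * s + (1 - α) * c) ⊂ N.above F qmsg (x t) s := by
  have hc' : ∀ p ∈ N.normal, N.activation F qmsg t p = 1 → x t p ≤ c :=
    fun p hp ha => hc p (h.active t ht p hp ha)
  have hss : s ≤ α * s + (1 - α) * c := by nlinarith [h.lt_one]
  refine (Finset.ssubset_iff_of_subset fun i hi => ?_).2 ?_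
  · obtain ⟨hiS, hsi⟩ := mem_above.1 hi
    have hin := (mem_recurrent.1 hiS).1
    by_cases hil : i ∈ N.leaders
    · rw [h.leader (t + 1) (by omega) i hin hil] at hsi
      linarith
    refine mem_above.2 ⟨hiS, ?_⟩
    by_cases hact : N.activation F qmsg t i = 1
    · by_contra hle
      have := (h.update t ht i hin (mem_followers.2 hil) hact).le h.pos hF hin hact hc'
        (not_lt.1 hle) hsc
      linarith
    · rw [h.keep t ht i hin (mem_followers.2 hil) hact] at hsi
      linarith
  · obtain ⟨i, hin, hif, hact, hsi, hret⟩ := exists_active_retains_le hF hq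
      (fun p hp hl => (h.leader t ht p hp hl).trans_le hCs) hex
    refine ⟨i, mem_above.2 ⟨h.active t ht i hin hact, hsi⟩, fun hi => ?_⟩
    obtain ⟨R, w, h1, h2, h3, h4, h5⟩ := h.update t ht i hin hif hact
    obtain ⟨j, hj, hjs⟩ := hret (xmsg t) R h1
    have := weighted_sum_le h.pos h2 h3 h4 (received_le_of_retained hF hin hact h1 hc') hj hjs hsc
    rw [← h5] at this
    exact absurd (mem_above.1 hi).2 (not_lt.2 this)

/-- In a tail, non-recurrent normal agents never transmit, so a bound on the recurrent ones
suffices. -/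
theorem IsTail.le_of_le (h : N.IsTail F qmsg α C T x xmsg)
    (hF : N.IsLocal F N.adversaries) {t₀ : ℕ} (ht₀ : T ≤ t₀) {c : ℝ} (hCc : C ≤ c)
    (hc : ∀ i ∈ N.recurrent F qmsg, x t₀ i ≤ c) :
    ∀ t ≥ t₀, ∀ i ∈ N.recurrent F qmsg, x t i ≤ c := by
  intro t ht
  induction t, ht using Nat.le_induction with
  | base => exact hc
  | succ t ht ih =>
    rw [← above_eq_empty_iff] at ih ⊢
    refine Finset.subset_empty.1 (ih ▸ h.above_succ_subset hF (ht₀.trans ht) hCc fun i hi ha => ?_)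
    exact above_eq_empty_iff.1 ih i (h.active t (ht₀.trans ht) i hi ha)

/-! ### Contraction towards the reference. -/

/-- If the count never fell to `n`, no agent above `s` could ever be active, since its activity
would force a drop. The set above `s` would then be frozen, although its members are recurrent. -/
theorem IsTail.exists_card_above_le (h : N.IsTail F qmsg α C T x xmsg)
    (hF : N.IsLocal F N.adversaries) (hq : N.AdmissibleActivation qmsg) {t₀ : ℕ} (ht₀ : T ≤ t₀)
    {s c : ℝ} (hCs : C ≤ s) (hsc : s ≤ c) (hc : ∀ i ∈ N.recurrent F qmsg, x t₀ i ≤ c) {n : ℕ}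
    (hn : (N.above F qmsg (x t₀) s).card ≤ n + 1) :
    ∃ t ≥ t₀, (N.above F qmsg (x t) (α * s + (1 - α) * c)).card ≤ n := by
  by_contra! hno
  have hss : s ≤ α * s + (1 - α) * c := by nlinarith [h.lt_one]
  have hbound := h.le_of_le hF ht₀ (hCs.trans hsc) hc
  have hinactive : ∀ t ≥ t₀, (N.above F qmsg (x t) s).card ≤ n + 1 →
      ∀ i ∈ N.normal, N.activation F qmsg t i = 1 → x t i ≤ s := by
    intro t ht hcard i hi ha
    by_contra hlt
    have h1 := Finset.card_lt_card (h.above_succ_ssubset hF hq (ht₀.trans ht) hCs hsc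
      (hbound t ht) ⟨i, hi, ha, not_le.1 hlt⟩)
    have h2 := hno (t + 1) (by omega)
    omega
  have hlarge : ∀ t ≥ t₀, n < (N.above F qmsg (x t) s).card := fun t ht =>
    (hno t ht).trans_le (Finset.card_le_card (above_anti hss))
  have hconst : ∀ t ≥ t₀, N.above F qmsg (x t) s = N.above F qmsg (x t₀) s := by
    intro t ht
    induction t, ht using Nat.le_induction with
    | base => rfl
    | succ t ht ih =>
      rw [← ih] at hn ⊢
      refine Finset.eq_of_subset_of_card_le
        (h.above_succ_subset hF (ht₀.trans ht) hCs (hinactive t ht hn)) ?_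
      have := hlarge (t + 1) (by omega)
      omega
  obtain ⟨i, hi⟩ := Finset.card_pos.1 (Nat.zero_lt_of_lt (hlarge t₀ le_rfl))
  obtain ⟨hin, hfreq⟩ := mem_recurrent.1 (mem_above.1 hi).1
  obtain ⟨t, ht, ha⟩ := frequently_atTop.1 hfreq t₀
  have hit := hi
  rw [← hconst t ht] at hit
  exact absurd (mem_above.1 hit).2 (not_lt.2 (hinactive t ht (by rwa [hconst t ht]) i hin ha))

/-- The levels solve `s₀ = C`, `sₖ₊₁ = α sₖ + (1 - α) c`; each raise loses an agent. -/
theorem IsTail.exists_card_above_add_le (h : N.IsTail F qmsg α C T x xmsg)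
    (hF : N.IsLocal F N.adversaries) (hq : N.AdmissibleActivation qmsg) {t₀ : ℕ} (ht₀ : T ≤ t₀)
    {c : ℝ} (hCc : C ≤ c) (hc : ∀ i ∈ N.recurrent F qmsg, x t₀ i ≤ c) (k : ℕ) :
    ∃ t ≥ t₀, (N.above F qmsg (x t) (c - α ^ k * (c - C))).card ≤ Fintype.card V - k := by
  induction k with
  | zero => exact ⟨t₀, le_rfl, by simpa using Finset.card_le_univ _⟩
  | succ k ih =>
    obtain ⟨t, ht, hcard⟩ := ih
    have hpow0 : 0 ≤ α ^ k := pow_nonneg h.pos.le k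
    have hpow1 : α ^ k ≤ 1 := pow_le_one₀ h.pos.le h.lt_one.le
    obtain ⟨u, hu, hcard'⟩ := h.exists_card_above_le hF hq (n := Fintype.card V - (k + 1))
      (ht₀.trans ht) (s := c - α ^ k * (c - C)) (c := c) (by nlinarith) (by nlinarith)
      (h.le_of_le hF ht₀ hCc hc t ht) (by omega)
    refine ⟨u, ht.trans hu, ?_⟩
    have heq : c - α ^ (k + 1) * (c - C) = α * (c - α ^ k * (c - C)) + (1 - α) * c := by ring
    rwa [heq]

theorem IsTail.exists_contraction (h : N.IsTail F qmsg α C T x xmsg)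
    (hF : N.IsLocal F N.adversaries) (hq : N.AdmissibleActivation qmsg) {d : ℝ} (hd : 0 ≤ d)
    (hc : ∀ i ∈ N.recurrent F qmsg, x T i ≤ C + d) (k : ℕ) :
    ∃ t ≥ T, ∀ i ∈ N.recurrent F qmsg,
      x t i ≤ C + (1 - α ^ Fintype.card V) ^ k * d := by
  induction k with
  | zero => exact ⟨T, le_rfl, by simpa using hc⟩
  | succ k ih =>
    obtain ⟨t, ht, hle⟩ := ih
    have hpow1 : α ^ Fintype.card V ≤ 1 := pow_le_one₀ h.pos.le h.lt_one.le
    have hnonneg : 0 ≤ (1 - α ^ Fintype.card V) ^ k * d :=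
      mul_nonneg (pow_nonneg (sub_nonneg.2 hpow1) k) hd
    obtain ⟨u, hu, hcard⟩ := h.exists_card_above_add_le hF hq ht (by linarith) hle
      (Fintype.card V)
    -- After `|V|` raises the set above the level is empty.
    rw [Nat.sub_self, Nat.le_zero, Finset.card_eq_zero, above_eq_empty_iff] at hcard
    refine ⟨u, ht.trans hu, fun i hi => (hcard i hi).trans_eq ?_⟩
    ring

theorem IsTail.eventually_le (h : N.IsTail F qmsg α C T x xmsg)
    (hF : N.IsLocal F N.adversaries) (hq : N.AdmissibleActivation qmsg) {ε : ℝ} (hε : 0 < ε) :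
    ∀ᶠ t in atTop, ∀ i ∈ N.recurrent F qmsg, x t i ≤ C + ε := by
  obtain ⟨d, hd, hc⟩ : ∃ d : ℝ, 0 ≤ d ∧ ∀ i ∈ N.recurrent F qmsg, x T i ≤ C + d := by
    refine ⟨∑ i, |x T i - C|, Finset.sum_nonneg fun i _ => abs_nonneg _, fun i _ => ?_⟩
    have h1 := Finset.single_le_sum (f := fun i => |x T i - C|) (fun i _ => abs_nonneg _)
      (Finset.mem_univ i)
    have h2 := le_abs_self (x T i - C)
    linarith
  have hpos : 0 < α ^ Fintype.card V := pow_pos h.pos _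
  have hle : α ^ Fintype.card V ≤ 1 := pow_le_one₀ h.pos.le h.lt_one.le
  have hlim : Tendsto (fun k : ℕ => (1 - α ^ Fintype.card V) ^ k * d) atTop (𝓝 0) := by
    simpa using (tendsto_pow_atTop_nhds_zero_of_lt_one (sub_nonneg.2 hle)
      (by linarith)).mul_const d
  obtain ⟨k, hk⟩ := (hlim.eventually (gt_mem_nhds hε)).exists
  obtain ⟨t, ht, hx⟩ := h.exists_contraction hF hq hd hc k
  filter_upwards [eventually_ge_atTop t] with u hu
  exact h.le_of_le hF ht (by linarith) (fun i hi => (hx i hi).trans (by linarith)) u hu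

/-- Under BP-MSR the recurrent agents converge to a constant reference. -/
theorem IsExecution.tendsto_of_mem_recurrent {fr : ℕ → ℝ} {t₀ : ℕ}
    (hx : N.IsExecution F qmsg fr t₀ x xmsg) (hF : N.IsLocal F N.adversaries)
    (hq : N.AdmissibleActivation qmsg) (hfr : ∀ t ≥ t₀, fr t = C) {i : V}
    (hi : i ∈ N.recurrent F qmsg) : Tendsto (fun t => x t i) atTop (𝓝 C) := by
  obtain ⟨α, T, h⟩ := hx.exists_isTail hfr
  -- The negated execution, with reference `-C`, supplies the lower bound.
  obtain ⟨α', T', h'⟩ := hx.neg.exists_isTail (C := -C) fun t ht => by rw [hfr t ht]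
  rw [Metric.tendsto_nhds]
  intro ε hε
  filter_upwards [h.eventually_le hF hq (half_pos hε), h'.eventually_le hF hq (half_pos hε)]
    with t h1 h2
  have h1 := h1 i hi
  have h2 := h2 i hi
  rw [Real.dist_eq, abs_lt]
  constructor <;> linarith

end LFNetwork

theorem mainTheorem1 {V : Type*} [Fintype V] [DecidableEq V] (N : LFNetwork V) (F : ℕ)
    (hF : N.IsLocal F N.adversaries)
    (qmsg : ℕ → ℕ → V → V → ℝ) (hq : N.AdmissibleActivation qmsg)
    (fr : ℕ → ℝ) (tC : ℕ) (Cr : ℝ) (hfr : ∀ t ≥ tC, fr t = Cr) :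
    (∀ (x : ℕ → V → ℝ) (xmsg : ℕ → V → V → ℝ), N.IsExecution F qmsg fr tC x xmsg →
      Cr ∈ Set.Icc (N.minState (x tC)) (N.maxState (x tC)) →
      ∀ i ∈ N.normalFollowers, ∀ t ≥ tC,
        x t i ∈ Set.Icc (N.minState (x tC)) (N.maxState (x tC))) ∧
    ((N.convergentSet F qmsg).Nonempty →
      N.PartialConsensus F qmsg fr tC (N.convergentSet F qmsg)) := by
  have hnormal : ∀ i ∈ N.normalFollowers, i ∈ N.normal := fun i hi =>
    LFNetwork.mem_normal.2 (Finset.mem_sdiff.1 hi).2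
  refine ⟨fun x xmsg hx hC i hi t ht => ⟨?_, ?_⟩, fun hne => ⟨hne, fun i hi => hi.1, ?_⟩⟩
  · refine neg_le_neg_iff.1 (hx.neg.le_of_le hF (fun t ht => ?_) (fun j hj => ?_) t ht i
      (hnormal i hi))
    · rw [hfr t ht]; exact neg_le_neg hC.1
    · exact neg_le_neg (Finset.inf'_le _ hj)
  · refine hx.le_of_le hF (fun t ht => ?_) (fun j hj => ?_) t ht i (hnormal i hi)
    · rw [hfr t ht]; exact hC.2
    · exact Finset.le_sup' _ hj
  · intro x xmsg hx i hi
    have hlim := hx.tendsto_of_mem_recurrent hF hq hfr (LFNetwork.mem_recurrent.2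
      ⟨hnormal i hi.1, LFNetwork.limsup_activation_eq_one_iff.1 hi.2⟩)
    have h0 : Tendsto (fun t => ‖x t i - Cr‖) atTop (𝓝 0) := by
      simpa using (hlim.sub_const Cr).norm
    refine h0.congr' ?_
    filter_upwards [eventually_ge_atTop tC] with t ht
    rw [hfr t ht]
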